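/- Let $n\ge 0$ be an integer and consider $n$ numbered coins of identical appearance, each of which is either normal or counterfeit. All normal coins have one common weight and all counterfeit coins have one common weight; the two weights are not known, but it is known in advance that counterfeit coins are heavier than normal ones (or: it is known in advance that they are lighter). Any subset of the coins, including the empty set and the set of all coins, may be the set of counterfeit coins. Arbitrarily many additional coins known to be normal are available. A weighing places disjoint sets of coins on the two pans of a balance and reveals only whether the pans balance or which pan is heavier; each weighing may be chosen depending on the results of the previous ones. Let $g(n)$ be the least number of weighings that suffices, in the worst case, to determine exactly which of the $n$ coins are counterfeit. Then, in each of the two cases (heavier or lighter), $$\lceil n\log_3 2\rceil \le g(n)\quad\text{for all } n,\qquad g(n)\le \lceil 7n/11\rceil\quad\text{for all } n\ne 3,$$ and $g(3)=3$. -/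

import Mathlib

namespace CoinWeighing

/-- What is known in advance about the fakes: either that each of them is heavier than a normal
coin, or that each of them is lighter. -/
inductive FakeKind where
  | heavier
  | lighter

/-- `κ.Admissible a b`: the positive reals `a` and `b` may be the weight of a normal coin and the
weight of a fake coin, respectively. -/
def FakeKind.Admissible : FakeKind → ℝ → ℝ → Prop
  | .heavier, a, b => 0 < a ∧ a < b
  | .lighter, a, b => 0 < b ∧ b < a

/-- An adaptive weighing procedure for `n` numbered coins. Either it stops and announces a set of
coins, or it puts the coins of `left` together with `p` additional normal coins on the left pan,
the coins of `right` together with `q` additional normal coins on the right pan, and goes on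
according to the result of this weighing: the pans balance, or the left pan is heavier, or the
right pan is heavier. -/
inductive Procedure (n : ℕ) where
  | announce (F : Finset (Fin n))
  | weigh (left right : Finset (Fin n)) (disj : Disjoint left right) (p q : ℕ)
      (onBalance onLeftHeavier onRightHeavier : Procedure n)

/-- The number of weighings that a procedure makes in the worst case. -/
def Procedure.weighings {n : ℕ} : Procedure n → ℕ
  | .announce _ => 0
  | .weigh _ _ _ _ _ e l r => max e.weighings (max l.weighings r.weighings) + 1

/-- The total weight of the coins in `P` and `p` additional normal coins, where `F` is the set of
the fakes, a normal coin has weight `a` and a fake coin has weight `b`. -/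
noncomputable def panWeight {n : ℕ} (a b : ℝ) (F P : Finset (Fin n)) (p : ℕ) : ℝ :=
  (∑ i ∈ P, if i ∈ F then b else a) + p * a

open Classical in
/-- The set announced by a procedure, when `F` is the set of the fakes, a normal coin has weight `a`
and a fake coin has weight `b`. -/
noncomputable def Procedure.run {n : ℕ} (a b : ℝ) (F : Finset (Fin n)) :
    Procedure n → Finset (Fin n)
  | .announce A => A
  | .weigh left right _ p q e l r =>
      if panWeight a b F left p = panWeight a b F right q then e.run a b F
      else if panWeight a b F right q < panWeight a b F left p then l.run a b F
      else r.run a b F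

/-- A procedure sorts the coins if it announces exactly the set of the fakes, whatever this set is
(none and all of the coins included) and whatever the two weights are. -/
def Procedure.Sorts {n : ℕ} (κ : FakeKind) (t : Procedure n) : Prop :=
  ∀ a b : ℝ, κ.Admissible a b → ∀ F : Finset (Fin n), t.run a b F = F

/-- The numbers `k` such that `n` coins can be sorted with at most `k` weighings. -/
def sufficientNumbers (κ : FakeKind) (n : ℕ) : Set ℕ :=
  {k | ∃ t : Procedure n, t.weighings ≤ k ∧ t.Sorts κ}

/-- The least number of weighings needed to sort `n` coins. -/
noncomputable def g (κ : FakeKind) (n : ℕ) : ℕ := sInf (sufficientNumbers κ n)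

end CoinWeighing

namespace CoinWeighing

/-- The number of ones among the last fourteen binary digits of `y`: the digits are copied to
positions that are multiples of four, and a number in base 16 is congruent to the sum of its digits
modulo 15. -/
def popCount (y : ℕ) : ℕ := ((y.mul 0x200040008001).land 0x111111111111111).mod 15

/-- The binary digits of `x` that are ones in `x` only, and not in `y` or `z`. -/
def privateBits (x y z : ℕ) : ℕ := x.xor (x.land (y.lor z))

/-- Both `x` and `y` have ones that the two other numbers do not have. -/
def separated (x y z : ℕ) : Bool :=
  Nat.ble 1 (popCount (privateBits x y z)) && Nat.ble 1 (popCount (privateBits y x z))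

/-- A criterion for one weighing to tell apart the sets of coins that the numbers in a list
encode. -/
def finalCheck : List ℕ → Bool
  | [] => true
  | [_] => true
  | [_, _] => true
  | [x, y, z] => separated x y z || separated x z y || separated y z x
  | _ => false

/-- Distributes the numbers in a list to the three lists `e`, `l`, `r`, according to whether
`x.land m` and `q` differ in `c`, more than `c` or less than `c` digits. -/
noncomputable def sift (m q c : ℕ) (S : List ℕ) :
    List ℕ → List ℕ → List ℕ → List ℕ × List ℕ × List ℕ :=
  S.rec (fun e l r => (e, l, r)) fun x _ ih e l r =>
    bif Nat.beq (popCount ((x.land m).xor q)) c then ih (x :: e) l r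
    else bif Nat.ble c (popCount ((x.land m).xor q)) then ih e (x :: l) r
    else ih e l (x :: r)

/-- `planCheck d S c` checks a plan of `d` weighings, followed by a final one, that tells apart the
sets of coins encoded by the numbers in `S`. The list `c` holds, in preorder, the codes
`2 ^ 14 * l + r` of the weighings that put the coins of `l` on the left pan and those of `r` on the
right pan, a weighing being followed by the plans for the outcomes balance, left, right. The codes
that have not been used are returned. -/
noncomputable def planCheck : ℕ → List ℕ → List ℕ → Option (List ℕ)
  | 0, S, c => bif finalCheck S then some c else none
  | _ + 1, _, [] => none
  | d + 1, S, w :: c =>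
    bif Nat.beq ((w.div 16384).land (w.mod 16384)) 0 then
      match sift ((w.div 16384).lor (w.mod 16384)) (w.mod 16384) (popCount (w.mod 16384)) S
        [] [] [] with
      | (e, l, r) =>
        (planCheck d e c).bind fun c => (planCheck d l c).bind fun c => planCheck d r c
    else none

/-! ### Plans for small numbers of coins -/

/-- The codes of a plan that sorts four coins with 3 weighings. -/
def fourPlan : List ℕ :=
  [49164, 65544, 81930, 81928]

theorem planCheck_fourPlan : (planCheck 2 (List.range (2 ^ 4)) fourPlan).isSome = true := by
  decide +kernel

/-- The codes of a plan that sorts six coins with 4 weighings. -/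
def sixPlan : List ℕ :=
  [49164, 278562, 114744, 81970, 802822, 344106, 213010, 49204, 49208, 344106, 311300, 540688,
   819212]

theorem planCheck_sixPlan : (planCheck 3 (List.range (2 ^ 6)) sixPlan).isSome = true := by
  decide +kernel

/-- The codes of a plan that sorts nine coins with 6 weighings. -/
def ninePlan : List ℕ :=
  [114744, 393312, 2146572, 1196420, 114856, 639424, 1753220, 1507744, 1065218, 2834514, 180528,
   590024, 2244688, 131328, 4210696, 2113794, 180708, 1196418, 2195560, 1098112, 6340636, 1687960,
   5390482, 147588, 1261954, 164176, 4489292, 459136, 2539812, 2769234, 2507010, 2113860, 2129972,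
   737744, 49548, 6307850, 4243604, 6488176, 2146308, 6471716, 540738, 409824, 4751436, 573828,
   1048704, 49492, 328072, 2244960, 82064, 295176, 32816, 5537932, 1065018, 4325392, 81994,
   1212804, 278572, 2621760, 82178, 4735110, 278884, 147858, 196816, 671766, 4849808, 1229200,
   278698, 2130180, 623040, 1098028, 294924, 65568, 98632, 1491236, 6324292, 540764, 7372836,
   557060, 16442, 1081760, 4260032, 409824, 1098112, 4735050, 1343500, 1163536, 557316, 6307852,
   4505828, 4210848, 4423792, 1589378, 4325424, 2638084, 4817024, 623040, 4243684, 163956,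
   3686426, 4391120, 3375408, 32772, 1212436, 4210698, 1180064, 2900296, 16642, 835720, 4735050,
   754000, 2294048, 4292816, 2654488, 344322, 2294080, 2376032, 1868168, 4423856, 229728, 2261108,
   426176]

theorem planCheck_ninePlan : (planCheck 5 (List.range (2 ^ 9)) ninePlan).isSome = true := by
  decide +kernel

/-- The codes of a plan that sorts eleven coins with 7 weighings. -/
def elevenPlan : List ℕ :=
  [114744, 1164168, 279584, 3196208, 574216, 17089124, 21578392, 754000, 29376556, 246704,
   17842872, 2114114, 8930624, 17334868, 25461156, 8552768, 2146664, 6375024, 427332, 1687952,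
   5882392, 1394058, 17482384, 65600, 25264560, 410372, 17023728, 20005658, 1098400, 16875744,
   18367370, 1655682, 4408960, 1246592, 180704, 6325252, 12616772, 2819408, 1212704, 18907460,
   9535912, 5260448, 2245440, 17056650, 12599332, 4457600, 19087728, 3408928, 16925074, 16875616,
   8996184, 2737488, 4293808, 49700, 49188, 25837904, 30441620, 17105352, 6569998, 3671040,
   1328010, 30425118, 607376, 573640, 4358388, 1868940, 1065992, 2375788, 17317914, 21233888,
   16827024, 21201584, 9487412, 770832, 25313600, 278542, 4210698, 1736976, 20070690, 10862952,
   181248, 557380, 180420, 6046340, 17580360, 4571880, 6571534, 7112260, 3278080, 2392868,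
   26067080, 12600370, 230640, 8536560, 4555304, 1131520, 4473378, 10519828, 640768, 672400,
   2196992, 11600144, 2115074, 4211842, 8668170, 737602, 19415618, 4211844, 17334536, 4472968,
   4736514, 21135968, 25182336, 10290568, 21119586, 5260420, 3426056, 1064962, 3704068, 2164288,
   16974368, 4261440, 1196928, 2491648, 1492388, 16793992, 2573378, 17580614, 2131712, 18629134,
   12599366, 2655248, 26492942, 6308382, 1639320, 1360932, 8635872, 25215100, 10093712, 181556,
   22069780, 13157452, 5932176, 1343624, 17318464, 3228698, 344898, 6374010, 14696542, 6357608,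
   229808, 1099412, 49220, 49472, 8963328, 25313350, 5391362, 8438828, 9454880, 12600518, 295488,
   557124, 3162406, 2392416, 31473754, 1327778, 4605094, 14745680, 83656, 5784604, 12731458,
   9060544, 411232, 25264632, 148048, 1082380, 3195708, 9241672, 13271124, 3212304, 3293974,
   311500, 2819408, 6439522, 9044176, 116304, 21020876, 8585408, 312524, 8863938, 476768,
   19939614, 10534956, 721472, 16810544, 17842236, 9732488, 6308886, 147858, 9454762, 1213220,
   21020772, 16826796, 2392388, 10503276, 21037792, 312396, 147968, 9470368, 4621476, 82450,
   1131570, 606994, 5375008, 2048770, 25198852, 16859888, 6309424, 8667308, 4572800, 50448,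
   820492, 25837826, 836548, 19022598, 8439060, 21381250, 8586432, 6373906, 9209028, 5293596,
   27705700, 9453746, 2638922, 17318402, 17334464, 12666082, 19448580, 26263940, 3719196,
   16826952, 1918336, 21021188, 1196928, 394432, 16827136, 4768280, 10600536, 8683716, 12648608,
   2262052, 509728, 540688, 804238, 1638792, 8536214, 25837904, 476512, 4867606, 19039072,
   2899980, 16859138, 9453604, 6340724, 25313334, 2671368, 30687400, 18121228, 2655496, 557328,
   18973280, 6669408, 10536208, 29655180, 4375588, 9519378, 12746864, 9028880, 5260848, 21529176,
   17564480, 2656016, 622992, 9011648, 2392896, 19121008, 14697492, 4506664, 4605668, 590088,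
   19153196, 21103328, 9061568, 214192, 804168, 2705162, 18006580, 688720, 29917208, 360672,
   148550, 672788, 704720, 4753092, 4440688, 8421648, 26296488, 1229876, 2179144, 3686424,
   19464216, 12731606, 1065254, 18891284, 19415872, 722752, 4735066, 657296, 148928, 29409352,
   29442106, 852800, 278788, 13141016, 2392416, 25248128, 17416896, 1229840, 17171104, 9503016,
   3261472, 20087060, 18006532, 9078164, 4556392, 8946816, 1327150, 5374128, 460320, 23085672,
   22118424, 4407344, 29393096, 13172936, 25198880, 10552624, 295240, 1737236, 8652160, 13681712,
   22364832, 2311680, 12993766, 25313620, 25280560, 27459936, 19251528, 8667168, 10880288,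
   9535776, 19202376, 19300896, 9716768, 558144]

theorem planCheck_elevenPlan : (planCheck 6 (List.range (2 ^ 11)) elevenPlan).isSome = true := by
  decide +kernel

set_option maxRecDepth 100000 in
/-- The codes of a plan that sorts fourteen coins with 9 weighings. -/
def fourteenPlan : List ℕ :=
  [114744, 3195672, 18402060, 67955460, 4608642, 1538432, 89189028, 134841736, 162552112,
   206982178, 48251976, 16924772, 168055908, 134978624, 6515760, 169497366, 141581882, 152584326,
   134353664, 25178112, 145014880, 935296, 7368744, 2254082, 83951720, 169362588, 18440578,
   139333312, 69634624, 6666240, 18894910, 35734616, 138592432, 34580160, 26810768, 176264592,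
   8887296, 18998024, 101605766, 27326512, 142741696, 104898800, 83951840, 5282336, 288770,
   6374922, 10823784, 84437526, 91208, 101754652, 25655680, 8671308, 83978258, 206063770,
   68184196, 16962244, 48775194, 101336082, 13162696, 117481672, 2117644, 24203824, 134234192,
   2306096, 5521454, 180628, 135598464, 218496, 2303504, 2167808, 71320784, 33760192, 19191872,
   12599344, 6416952, 37781588, 33570836, 17209380, 4477954, 307272, 4342324, 25335952, 540738,
   89172016, 72688288, 2248752, 68208800, 17010832, 168871812, 169624836, 39376028, 1264800,
   902336, 5407396, 7243328, 76639496, 86549072, 1645568, 18948648, 77744176, 134631970,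
   167788650, 68329744, 144104484, 3603204, 42234114, 145557760, 1131784, 101269586, 72517684,
   68307970, 21514442, 68881424, 201507808, 713088, 17195298, 50348408, 76115072, 201474692,
   1592584, 142950602, 249536, 35995722, 134385572, 68209712, 201410864, 176259440, 23122040,
   12670098, 76235090, 173556242, 107160592, 36463106, 15292498, 43058224, 83960584, 12609718,
   353096, 21275204, 35145218, 74992666, 134270980, 23437888, 42000396, 94398758, 75522376,
   241714252, 88246356, 67544576, 3491360, 964288, 67256370, 68387728, 145493312, 18217248,
   9515008, 135824640, 694016, 143318096, 8560660, 155226224, 2274368, 142639312, 159531298,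
   50356752, 51507624, 17918640, 75784586, 153588032, 23159370, 459552, 414272, 17690696,
   151011650, 17854502, 145773598, 105407042, 68439470, 4244680, 19553026, 12673090, 84009576,
   67389028, 12870656, 812290, 67855938, 16871698, 143017282, 37945360, 540940, 9070850, 84172866,
   151081008, 134762754, 397888, 545044, 4780232, 5363360, 88105526, 84951590, 33152, 203653936,
   134234242, 10313738, 549458, 172167344, 34690696, 70069320, 540694, 2583138, 134269472,
   25735504, 1607696, 26238998, 100730384, 42025256, 69591392, 100745400, 109133826, 71648480,
   4752460, 168068420, 33583114, 135562792, 20006968, 67919942, 5534756, 205587488, 13527106,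
   9078020, 9039176, 9741572, 3796752, 37769408, 67684756, 42025136, 2183234, 345538, 6307858,
   362080, 71352836, 67388674, 168072960, 167805600, 37749248, 4456992, 18411648, 8930324,
   25426240, 67365024, 743570, 13306064, 35713604, 68406144, 438788, 104678154, 105669130,
   17017024, 69779780, 136614468, 35680328, 5797008, 251152, 77678696, 278532, 79972514, 33658208,
   78671156, 151898504, 17844864, 768064, 16781312, 67649792, 22630544, 9521416, 135367432,
   24147972, 70429444, 136437512, 71492100, 16848904, 169350784, 135301124, 8738946, 100941966,
   209993924, 38367376, 222316720, 69511488, 2200656, 44126472, 164356, 201670984, 71377992,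
   201474452, 83929152, 42239364, 68379792, 71311872, 68176906, 3045696, 111182132, 19054708,
   73444360, 86819144, 86534732, 71360688, 69291066, 33605252, 17887364, 69560328, 67125250,
   1250688, 67455688, 201411602, 68462976, 464896, 33661072, 6404104, 1141768, 67149896, 4474948,
   77743382, 136386568, 3432456, 2405444, 83943684, 17973780, 13649956, 135843080, 1757952,
   18956866, 151537858, 153112654, 25254304, 1284768, 90202626, 169444224, 203491872, 33652904,
   8707072, 57758248, 13686820, 139084932, 2269764, 69266036, 37863592, 162080, 9461766, 41959884,
   10655748, 142754944, 65048684, 155736640, 63025376, 2713920, 11553042, 35197568, 33576194,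
   161499246, 748480, 67715146, 68757640, 135432356, 67709312, 1124352, 590144, 2674264, 29487200,
   209799450, 109069468, 134235160, 136331322, 134383924, 77704232, 19429702, 153211440, 742530,
   201458816, 67879376, 67657748, 35713908, 67784320, 192991416, 16798250, 16801888, 17076360,
   2154540, 77121948, 33718944, 67888592, 141121098, 143147200, 109568, 202129410, 8966344,
   176215216, 19429378, 136462434, 176968768, 92324080, 35807760, 151704128, 134760640, 2777158,
   136928322, 4440208, 35688724, 76033280, 67829968, 138529960, 1270912, 134434864, 203443242,
   19034432, 134797508, 16992672, 2638148, 84068708, 3164466, 67125282, 4538402, 8601936,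
   226951520, 18911772, 348170, 1100704, 69231420, 134271808, 2114658, 142626854, 19968052,
   140542048, 67387394, 6598692, 4787288, 2323472, 168050826, 152129546, 101196928, 218153196,
   50872458, 36197650, 135350434, 156391586, 72638474, 38813738, 168317130, 6737444, 6975554,
   211846496, 235292548, 17355336, 243302756, 1360288, 67420204, 209994888, 68889984, 60854356,
   25258114, 8438840, 67183632, 90794072, 18929688, 201442440, 149520, 134283288, 136927304,
   953472, 36008298, 1282176, 67349520, 16799744, 201359372, 17008720, 73557008, 59191392,
   88162976, 17318482, 209750240, 5502464, 1727750, 2708290, 52457570, 69484576, 8931520,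
   17100900, 142609408, 10502172, 3211832, 17397896, 248880, 18324128, 84967436, 67127298,
   101900308, 17005138, 83018, 118521860, 629840, 168153256, 33579008, 36398674, 118513708,
   151060584, 33779744, 1067008, 994496, 16857088, 51400748, 738496, 353320, 748688, 68183040,
   134302880, 68158464, 17021632, 102065290, 33607728, 117457630, 511712, 255148586, 33849384,
   1300528, 16791552, 34190536, 1432224, 67592194, 83945484, 10552360, 42497228, 8443936, 33808,
   67167248, 27801600, 202017920, 33833506, 323624, 234897952, 85008424, 246304, 2634240,
   19429912, 103309918, 50655272, 67577920, 582784, 185713312, 33715216, 2652166, 35115168,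
   167788582, 101049384, 17651904, 1178640, 134895686, 103048744, 142754864, 134235264, 8931338,
   100679714, 35951648, 136596490, 167793688, 136316928, 682114, 153115178, 75538440, 75687968,
   16908432, 1309856, 33558528, 135331896, 1475620, 134434864, 33648770, 33670232, 83992672,
   18911300, 17283264, 34919460, 33558528, 101015648, 2358304, 50384964, 752848, 90192, 19107936,
   2202704, 167986272, 109696, 117530682, 17037520, 492704, 100687876, 100713476, 119619698,
   167854274, 67496168, 368736, 16904272, 35778680, 167887992, 134336568, 18159656, 136464448,
   63488, 2225240, 33566720, 9060752, 4505800, 118530480, 55472322, 16828712, 18111136, 151666880,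
   19954218, 134254080, 18944, 21658112, 4914240, 17619712, 50901064, 1066288, 3734800, 50909648,
   19153506, 18925664, 60846082, 117465218, 50381488, 18106786, 253805408, 2935872, 71885840,
   67685776, 67429440, 54554632, 205571712, 67117056, 84041920, 92307648, 27457856, 201476736,
   50483648, 3300608, 121692736, 134251584, 151011336, 68201992, 19020288, 42747146, 34885930,
   19279968, 67300544, 8415360, 84722568, 201870464, 167826120, 33613312, 701712, 69789192,
   36204544, 8929554, 36459784, 137403928, 4744256, 17334856, 33707584, 8963144, 139349570,
   8571248, 136367128, 144739616, 139219584, 67256896, 138958984, 18105128, 34736032, 1077888,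
   69397056, 77605888, 113811528, 136714816, 40383488, 33607704, 42005640, 111173738, 1593610,
   541186, 50376720, 4494976, 118104448, 50626664, 712848, 33857600, 6316136, 1486112, 282634,
   151427552, 222464704, 134502656, 100958400, 4483074, 218155624, 239502560, 1329162, 9755784,
   235701056, 71360600, 138582096, 34365514, 1346696, 203835680, 6572128, 33605200, 17336384,
   218155448, 18019104, 76565648, 88481984, 45117696, 77653272, 53006672, 137385488, 316672,
   34619666, 33996992, 205537488, 67551712, 590144, 1245840, 17389648, 51388928, 218254084,
   1605636, 42012808, 42030440, 146292758, 52449804, 201868438, 41988104, 201607686, 40457752,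
   8474992, 67838224, 6846978, 100746376, 9459976, 636992, 151279912, 106030264, 1185808, 4348002,
   260325518, 145818664, 17459714, 37310490, 8547330, 20374276, 125886588, 1671704, 134404608,
   629760, 34423050, 10490880, 53523232, 167809052, 180408564, 88260788, 34337168, 110133556,
   1655448, 21067784, 346184, 87296, 67332944, 68231432, 20990036, 218382604, 67125252, 71322624,
   1134336, 101999364, 67332672, 68366080, 16939024, 51983128, 67149840, 34190408, 84116320,
   17402184, 67462152, 880960, 67202056, 35238680, 17649738, 767040, 52278024, 120627732,
   135302784, 17075008, 4439056, 18946560, 16885968, 69569864, 236480, 202737288, 21276804,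
   100958784, 8466440, 17150144, 16859650, 46806160, 75910438, 25196674, 251822612, 50815778,
   35952136, 363552, 138693258, 22528, 12778656, 4569640, 67461258, 86075674, 234897832, 42157328,
   25248176, 67308592, 41947136, 25196712, 109077540, 33558528, 40580624, 50922120, 8548352,
   6323744, 67330448, 41988284, 83919384, 67685888, 142908448, 147744, 17725440, 8393728, 429088,
   262432, 27466000, 256384, 167821324, 4749336, 8536198, 2311698, 100754066, 10559776, 38191652,
   33935912, 143055908, 33599616, 33657376, 870154, 40203296, 138599060, 23455784, 103072004,
   170181420, 33682576, 69518884, 936196, 117384, 203904, 52752428, 33833614, 2453802, 55296,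
   201475730, 7206920, 67184256, 5208192, 4832256, 506368, 429088, 16877592, 104890412, 4787728,
   205553700, 241696, 202015764, 50892812, 953344, 142710072, 134382596, 23087648, 34157584,
   365192, 67325234, 134302738, 205588536, 73680424, 127648, 69484836, 201542434, 56832048,
   67267360, 69787652, 21065754, 67790342, 359456, 203704612, 52433408, 67858320, 170411284,
   67652500, 751488, 611336, 111698198, 134301104, 5073032, 652304, 255902260, 75566104, 16834816,
   4309512, 134496522, 17453334, 135225090, 17685256, 4354080, 55128592, 596480, 249632, 67395590,
   4489860, 125870384, 368256, 151552388, 50442288, 16889872, 4236288, 29661348, 35689476,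
   33665040, 251691396, 18975008, 17335056, 11054336, 50638884, 25467168, 235012144, 4859392,
   9153808, 624152, 234914600, 75769856, 38912, 83929112, 497952, 159482168, 563208, 117481492,
   2467368, 821252, 184779408, 34145664, 136678944, 767376, 67216408, 218204328, 51155212,
   252215684, 369792, 134287648, 4244040, 147972, 8715268, 2264336, 8428676, 67276544, 201442832,
   50508036, 73428496, 14961674, 67396928, 23369804, 180638790, 167809684, 193040472, 117465244,
   3425800, 33740112, 16841216, 33571968, 184898058, 1365120, 152082, 1360008, 8490000, 77753616,
   134402960, 67331152, 117711552, 60858708, 4497984, 18884608, 226789700, 161581136, 38056516,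
   21310144, 67151872, 251724432, 16810112, 138741376, 16824320, 4212226, 58880272, 67149832,
   33834506, 19192584, 445824, 71338624, 50356624, 134536200, 17058176, 21395586, 73425418,
   77636616, 50376712, 4636160, 111166744, 142760192, 100688776, 155664, 35672074, 33612808,
   10503432, 67266578, 100934400, 44438784, 10765576, 280712, 58782096, 42128768, 316040,
   17230720, 4496904, 2256912, 44331266, 243548554, 8846592, 218120450, 83919504, 33964546,
   100696208, 1379968, 204539656, 1275026, 100680850, 68314644, 68266376, 50413762, 68495232,
   26573192, 85175168, 75688384, 134432976, 151556, 34735872, 19003408, 25182214, 75530388,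
   86198608, 42307912, 75777036, 153436994, 203506002, 142607360, 41971840, 33837066, 67486528,
   2294864, 85338880, 19945744, 7500310, 3401472, 17842454, 147869854, 35835972, 1227008,
   101041088, 235980680, 24209922, 218235200, 151259200, 1196178, 4345344, 67256612, 69493292,
   353290, 201345496, 15034402, 6840342, 76081424, 2114882, 169103490, 105136868, 88105056,
   109273234, 44127552, 17384002, 18899252, 141102160, 75555012, 11570436, 25221220, 72377876,
   72622752, 29403172, 3497218, 21000864, 3191812, 159402022, 84953106, 25250288, 3824660,
   84444048, 68330628, 1434144, 6513234, 18905092, 33776832, 18950664, 681984, 25184312, 34685720,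
   172004880, 4240448, 348768, 17893760, 100689512, 140789292, 156272792, 176226744, 201343188,
   321028, 25391106, 3196444, 135350536, 183044, 101720192, 75623808, 2147852, 33727120, 281608,
   67266768, 34889868, 19013648, 16851072, 92162, 134235284, 175132690, 46162948, 8711556,
   176182274, 8933696, 19425608, 201411528, 1066018, 134338176, 142709960, 151093888, 136534112,
   68174886, 5373064, 3276544, 29388866, 17887360, 10748992, 3426340, 48264214, 168346564,
   138986564, 94462274, 52474160, 168054790, 354338, 153207664, 151210338, 109110688, 205555852,
   135318020, 138975824, 6322226, 4252196, 17326528, 33873956, 3678464, 168314764, 54715012,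
   675972, 234915024, 203131664, 39940658, 152361732, 67470568, 72672292, 235046224, 201443648,
   1271810, 169103620, 16896320, 152324358, 33603620, 19032098, 34165058, 4223010, 69296130,
   2656064, 27555944, 75792800, 68700698, 49420, 69224036, 9758980, 38167718, 5284400, 36004618,
   151142580, 100787072, 67193034, 68706566, 16797732, 109142186, 8877410, 21540892, 33982400,
   49316, 151208944, 84590740, 83910668, 105136780, 1990150, 8708548, 107776, 8923136, 4535816,
   33984864, 134547592, 1378312, 140531780, 67684428, 67430404, 67234144, 33653080, 43012148,
   19978552, 4324352, 116064, 71641672, 151389056, 88303842, 1206276, 201900428, 2652224,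
   68749464, 139774988, 67158268, 134301826, 33611884, 101204550, 34095308, 201343020, 9479200,
   962692, 1730962, 2246912, 17482116, 43552788, 35983656, 2148652, 2414860, 100827424, 172003460,
   33572096, 138434692, 235684174, 25616612, 142920012, 134239750, 33611820, 37917876, 8446084,
   3373344, 2260048, 138989148, 174605322, 182724, 67149888, 12596224, 12090372, 6575692,
   10527808, 33838150, 34780288, 83992760, 67125388, 25325764, 20988442, 67546116, 16990994,
   51725066, 51429636, 12603484, 151179616, 8407056, 134497350, 71352916, 134414544, 201671106,
   4223116, 138695234, 202131524, 237291340, 346346, 61444, 37810800, 48410692, 203457872,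
   9787402, 69231618, 201427416, 33640642, 67166476, 67322066, 1332874, 138695780, 1135666,
   11587844, 4358180, 80768176, 4840528, 151785920, 153635074, 138710560, 22092448, 224674402,
   18903298, 8439908, 16900576, 2479648, 68242562, 75563472, 4294720, 144464900, 15246420, 90560,
   26237312, 87313158, 24398370, 136626788, 1177136, 1668098, 135369904, 37840608, 83905280,
   36749604, 4293328, 135219010, 135285408, 9068742, 5848064, 16806144, 101754656, 142622818,
   80249924, 143492288, 37835362, 17057924, 10014848, 72838656, 75580674, 50987920, 136724800,
   139058304, 73786944, 18264836, 8421452, 83944148, 136502784, 19524176, 35795456, 140086792,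
   1102608, 139644548, 9541016, 37782036, 8689928, 21100616, 29454354, 80046146, 37810260,
   33612368, 31479880, 34915844, 33607756, 75597000, 204539432, 9812232, 16816140, 10520656,
   16843392, 5445632, 75550080, 8572288, 15768576, 205539560, 13126788, 8453152, 8448324,
   29667424, 39974480, 381632, 221268532, 142623810, 34706960, 42010080, 68740612, 8437924,
   67191872, 202149504, 1397376, 8702052, 1120272, 3207968, 1339524, 201690144, 33641490,
   201869316, 83970752, 142727408, 34690738, 35743314, 203475204, 33838084, 67168304, 86534400,
   8439936, 9505824, 67233952, 75590848, 75554884, 44085328, 237027940, 84003424, 67675140,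
   69494816, 27351104, 17367760, 34170432, 803208, 6344256, 4780564, 58741174, 50393864, 67272708,
   220219662, 5471746, 56660492, 3237130, 4293696, 51466762, 69594440, 25202712, 16826412,
   27301920, 71320164, 21786826, 8930308, 2315552, 135879178, 138450436, 5282824, 34628864,
   9537792, 29436072, 8516960, 4856512, 71419592, 17140232, 84019728, 33644738, 83913220,
   100753992, 8737224, 168874260, 67166736, 650136, 73965636, 71362572, 8407046, 5335050,
   25182402, 1348000, 42618886, 34643980, 34693162, 1254144, 75580426, 5307416, 1106188,
   135283996, 69289578, 142726376, 26239140, 134333288, 4227624, 169988, 257312, 24864, 134469408,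
   16848896, 4225028, 95232, 33583108, 71886348, 33648642, 194052, 94498, 591512, 37818408,
   127400, 2222144, 67135520, 33574922, 33648840, 33681504, 67234120, 77638696, 3167750, 1101992,
   101474690, 3191072, 201674280, 1464192, 41979992, 8417282, 9459074, 70313484, 10504196,
   144903232, 8610880, 80751744, 134305184, 17340424, 8477858, 72393220, 219171500, 2151432,
   11570184, 8543328, 75777124, 4311256, 35722240, 15220804, 152076932, 34767876, 135285924,
   167788556, 4735636, 67257890, 167953984, 33649728, 100753762, 75531328, 21002350, 12675146,
   135289600, 72805888, 25262146, 18272772, 17914376, 14699576, 82084900, 67685268, 213928132,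
   5268006, 46166084, 13135936, 4932674, 57892, 21160516, 61988, 155210420, 140041744, 25192768,
   142868704, 71338520, 255344, 67651140, 167924804, 4584000, 135615010, 50389604, 138466404,
   134860608, 88754198, 261120, 33644880, 8479056, 10001792, 70279460, 59256896, 17320004,
   67135488, 37835360, 25190464, 8446240, 91648, 34669728, 4745732, 5775360, 4289536, 8712416,
   251691124, 4805186, 84470336, 17352964, 25188672, 117514784, 9501988, 8457280, 16839168,
   83976544, 545858, 142639184, 135547652, 206098000, 84208388, 151329088, 135323136, 67439616,
   88107522, 8493408, 85033760, 92418, 25196614, 8453396, 38126144, 34632198, 69264704, 152062502,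
   8935872, 11066688, 35156356, 5321216, 3196452, 38293574, 117344, 54292742, 101736484,
   142627044, 25477156, 25964992, 12678152, 76704786, 159406138, 41959482, 33637466, 214073540,
   4757512, 67264564, 4473988, 109068346, 34676792, 135059532, 167858290, 72428048, 142622794,
   185440, 219203620, 54788, 54542924, 9457714, 105922606, 117336, 18380812, 33678856, 345090,
   50414138, 69528840, 77930792, 62935136, 21291076, 1235236, 8582304, 33726500, 134335096,
   2656276, 201838048, 5279748, 21303400, 2191362, 25184448, 71370920, 146856136, 34272640,
   2154240, 25198856, 70347562, 202393862, 9495940, 84623554, 25174016, 213942472, 6445158,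
   10574082, 203458628, 3294980, 140696132, 1175304, 10613832, 6378048, 75513926, 10641728,
   136332876, 225346, 1177984, 142678080, 8552516, 42070216, 138953284, 211846220, 1205664,
   37778436, 101237828, 16937184, 211829098, 153127236, 17846790, 73559556, 168842506, 122376,
   136364108, 67676288, 210292040, 3196420, 9624836, 41988356, 33706368, 70838016, 8441932,
   135452068, 67259398, 37840522, 11692294, 1135624, 34752260, 134433698, 4213444, 42013760,
   54848, 4297864, 8516616, 58432, 1275650, 21131334, 111174950, 44160328, 4213828, 1159584,
   3166978, 67331842, 143742344, 83912964, 4277826, 4436160, 8481802, 144723268, 201343366,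
   8512960, 2317890, 97280, 39921152, 69315168, 59334856, 76631458, 17842190, 84068932, 16924934,
   71360684, 68249512, 24139780, 83968170, 16941124, 73418754, 186688, 101867908, 39351432,
   203965002, 67151108, 2225504, 85632, 42030146, 19519816, 33768386, 68174982, 33666304,
   16861250, 52453442, 2246980, 4748290, 39871590, 26310922, 8442952, 153864512, 208178244,
   8445956, 33591844, 148916292, 134251268, 1133952, 69240332, 205669956, 2638148, 58741060,
   25346292, 101451584, 113262790, 138429620, 6355520, 136875604, 138577444, 142712064, 147085450,
   8937618, 77086994, 25747652, 22127232, 17097092, 143280258, 41050642, 134631168, 69648,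
   29380610, 143201424, 53018904, 134452128, 79750356, 12915776, 67330688, 144907536, 134284352,
   67387490, 26255776, 206343812, 1622804, 4285010, 9752708, 75525122, 9482496, 4547586, 25516320,
   1585664, 142888194, 631680, 209849376, 50549298, 117793730, 21063810, 85999894, 8701376,
   84951680, 71650434, 86001938, 4547584, 24664082, 155797586, 3786512, 135042560, 75777286,
   155273872, 17163144, 34035202, 84402752, 18996032, 140526614, 125968, 152322946, 73812484,
   4715136, 167854226, 251691652, 118628784, 19022342, 136662274, 134628032, 13674528, 24402436,
   77982824, 205801984, 8425636, 134775056, 18967106, 20490500, 314372, 143839648, 2370592,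
   159732002, 169230854, 234931684, 71378536, 26831114, 283660, 139252420, 134633538, 92309728,
   187978278, 160973190, 12905472, 67806288, 167809292, 139500688, 243302596, 84206308, 186683452,
   3289120, 31477800, 134500866, 88697424, 201379556, 136369204, 67226512, 138494674, 164124690,
   138445952, 92555298, 100680066, 153147444, 67709200, 2225184, 21055634, 122699956, 4309744,
   20989958, 29694112, 64032944, 143672472, 2841922, 34890112, 579860, 67201808, 12604420,
   50652044, 76115330, 880258, 172021272, 17322368, 21772288, 136337504, 4478464, 34107472,
   323776, 135021378, 9512992, 100786848, 140530726, 50385076, 2156836, 8704420, 5076096,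
   34469824, 84959234, 19945490, 167888632, 8623360, 134499620, 75689120, 167870880, 4499496,
   134270240, 38036646, 151142534, 6446592, 138462344, 22037176, 2180610, 94496, 80896176,
   144727110, 1631508, 1066112, 2674436, 92301556, 106455686, 109315328, 43013150, 32530470,
   168116962, 4835536, 178274358, 9114816, 100696180, 8438812, 213506, 90162, 838156, 289824,
   117392, 2187786, 42754246, 202655750, 69239828, 8514688, 9786370, 140598322, 29913222,
   102819104, 8425872, 118571440, 10545188, 69281088, 2681616, 6335492, 109076770, 579712,
   143216770, 4485152, 143218064, 139745324, 6349940, 38289922, 142754144, 68447754, 142623106,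
   136337410, 205718576, 142724528, 34832, 14770194, 1139968, 27439472, 67389862, 67185472,
   8421568, 528384, 210944, 285198, 134272524, 75525122, 226574768, 167790528, 33837190, 53348,
   2187088, 160733220, 176456864, 1623700, 387104, 142646320, 95232, 75579522, 134561826, 8439008,
   169362566, 139057808, 135320704, 25331764, 8688644, 13389900, 168366672, 59027844, 4271248,
   171480592, 3939328, 8512720, 169690498, 4321808, 136712512, 17152576, 168040064, 1091092,
   2202928, 50676608, 35676160, 69266436, 374944, 236470672, 100770272, 33923936, 135284992,
   174101588, 50438992, 137445906, 83987024, 164647098, 9285952, 48521316, 2149120, 6325364,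
   69543008, 1417600, 11565056, 33588032, 38446084, 1154304, 134383840, 134250832, 101491336,
   33666096, 35299588, 167940628, 92309876, 134255888, 219284224, 203654976, 69239564, 3224832,
   169378964, 19247936, 83954400, 6341652, 107759106, 5303808, 624336, 5592704, 142708160,
   134971728, 4232256, 177030218, 50451024, 13409284, 5515776, 8456544, 113152, 15887382,
   29778050, 4824256, 142919812, 69240140, 68200584, 1148544, 5289092, 110141824, 33793088,
   8488336, 234368, 75596240, 72376976, 25776512, 121651346, 824512, 70001216, 321572, 219187504,
   1699088, 33607760, 135021058, 4460096, 2198864, 134512772, 5542532, 21027424, 212159746,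
   134318256, 13189202, 136581120, 136895504, 167805044, 53440, 68275600, 74476038, 151884736,
   193544402, 303652, 8747104, 69509700, 375616, 45101312, 42246532, 33609600, 203541328,
   167789890, 300612, 130064500, 33624256, 3183152, 301440, 1196928, 1461408, 5405696, 6325316,
   2147072, 103368266, 42075504, 469248, 92643752, 25186568, 80775184, 101736496, 69485902,
   201345542, 67273296, 79717408, 25198632, 214027416, 37025548, 69297672, 75554840, 413730,
   12965928, 2480960, 136764256, 37765314, 88654536, 8553552, 37905586, 68037248, 76054556,
   203835494, 17076420, 174195248, 75861288, 68273552, 101057216, 42505664, 74843680, 238568724,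
   136665864, 109331848, 68756736, 219416864, 4999752, 2946316, 33832972, 201605218, 4856016,
   83946180, 96518260, 10670372, 72470176, 34718368, 37797940, 10522636, 1606288, 101114528,
   213993624, 140607600, 1859854, 147013778, 2718722, 9893252, 67551588, 178290744, 5890696,
   6582788, 79913056, 1483908, 72672424, 151224880, 68881808, 136532768, 28360984, 2432000,
   3457320, 67223752, 42239144, 2181712, 139511436, 8595728, 2506790, 52613652, 76563474,
   117596644, 67126340, 138708484, 17404224, 68587396, 152326816, 202083920, 139482144, 168204196,
   138615328, 238848, 135958288, 8859840, 97536024, 50508736, 35676672, 100705320, 3003968,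
   80399444, 25319444, 142740496, 19964200, 25985164, 17207744, 36717610, 14181394, 204489492,
   961088, 46583844, 155556448, 9993476, 18436608, 84427344, 161681456, 79202588, 42115072,
   8432640, 134940432, 73450600, 151029796, 37806240, 138957890, 93874200, 24375856, 361928,
   142790768, 176312418, 135549448, 9995536, 109371532, 203572852, 103899938, 209993804,
   168120706, 218205024, 2272800, 86581256, 156160, 78998794, 69894224, 26239256, 25930000,
   17988000, 201359384, 10536200, 6727264, 171475224, 77948266, 168312972, 234897476, 11653168,
   34435722, 135283236, 136337664, 144902512, 12636296, 143853840, 154662, 70329096, 251740312,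
   34193992, 34934944, 28924168, 134465616, 139493512, 136433768, 4543176, 2411340, 34701984,
   38970032, 134943232, 50463296, 4743296, 12706992, 88205544, 9495688, 25198860, 109207922,
   137004564, 134995280, 71459410, 1394952, 11906336, 6408776, 770256, 86116432, 40949304,
   135038400, 9670960, 69394736, 92561612, 2126338, 235324384, 143018466, 76071104, 10051970,
   10629392, 20576, 147882152, 168038496, 9651634, 92662120, 202998168, 16998546, 201493652,
   135857680, 151525504, 134283712, 50529040, 298624, 134840528, 8691784, 5465138, 155308216,
   135040516, 151291980, 1746964, 4403280, 88418856, 4318240, 9843968, 143363408, 52638272,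
   8594480, 134680256, 2886208, 168661696, 67912582, 134677600, 39196192, 205799434, 77889832,
   235013136, 3090240, 17465492, 7697952, 589840, 67305904, 656576, 22036520, 67790342, 136977424,
   19450696, 67436552, 67405956, 134545568, 21608472, 10502154, 70420000, 16924768, 6200832,
   151394528, 36872976, 143265808, 180916440, 69239832, 9080000, 201474272, 134414608, 19561300,
   36218200, 33747744, 17596872, 156125888, 170201184, 8473600, 67602464, 209964192, 1222656,
   58991008, 34514116, 110634112, 10587424, 1101840, 101089508, 4362788, 169903648, 1712272,
   34186312, 822984, 17283200, 8967172, 172249280, 4606016, 202391736, 105259584, 67789200,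
   44320104, 17594946, 140659808, 135073408, 96534768, 1640848, 201722048, 226805984, 17521346,
   9345472, 35858032, 33890688, 68816000, 209832016, 76197060, 2714128, 6470180, 2394368,
   33783920, 35852896, 9328896, 147116168, 76500288, 135005504, 38949520, 184570592, 201475360,
   20478480, 135813768, 117612772, 155586784, 138806368, 169935144, 219251496, 11701536, 33732096,
   117613232, 77768752, 35984384, 68191284, 59285580, 100704392, 10566736, 17478420, 125870120,
   19118128, 859648, 43560968, 67314816, 136483380, 33793072, 101319824, 11189328, 67604128,
   67217992, 92669984, 17142280, 151158948, 134420640, 2726912, 84731912, 4910784, 75712544,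
   69271560, 11618314, 10650932, 8559744, 2284064, 69405184, 16892112, 71327872, 134382368,
   3353136, 51499952, 154243888, 38164166, 153113106, 33968608, 2547780, 209781832, 712900,
   7359000, 35805008, 21062312, 3613216, 23204416, 176295984, 1358860, 522304, 35840564, 67421536,
   205537370, 1624072, 17613120, 67462920, 77095058, 67387496, 68176914, 413476, 121724976,
   655952, 22042628, 6724100, 3222048, 25481408, 67437672, 101205002, 141711408, 10605824,
   17986342, 68191256, 1702912, 59080936, 35934210, 1248288, 1413512, 19948056, 139615766,
   68716556, 25921616, 151667410, 37925392, 88629326, 67814612, 84034, 27285760, 6592576, 3196432,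
   84050160, 159404098, 174757460, 246224, 172163312, 19112464, 42787976, 8470608, 170280550,
   19010384, 121872592, 155357236, 2204680, 37052458, 160471308, 33972580, 219171130, 168312968,
   33772576, 5650464, 71582240, 6562368, 713408, 139643060, 7423032, 102826296, 34230480,
   79718410, 202459912, 201622284, 419938, 138694698, 155517480, 247481468, 33904416, 50488080,
   16926800, 117506160, 4538920, 147776, 18098432, 138595904, 84975668, 201477200, 41996312,
   4406784, 1267472, 810304, 674128, 67684376, 1341476, 13323344, 17307904, 139584, 218169608,
   37806132, 1465632, 138560530, 138824288, 38037028, 134928468, 134300712, 8482818, 209830992,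
   9449728, 168837688, 819976, 1226624, 81953860, 84748680, 69591080, 87403272, 3773960, 72958984,
   2412612, 202608176, 34268756, 33940512, 2901252, 169952112, 17236448, 160235784, 19960600,
   67562944, 4999232, 109109272, 3847440, 68698890, 105030704, 35947560, 37914224, 201376076,
   8605986, 151574552, 418112, 23229010, 9982988, 740928, 33768032, 101270616, 34103504,
   140658736, 34235732, 1657864, 8739840, 33621024, 184680560, 134811664, 3194908, 56709672,
   157728, 9200704, 8670274, 151570504, 151830988, 33801648, 156780570, 511296, 658448, 143432776,
   33727584, 8557616, 4631232, 34644904, 151180016, 16941296, 134349856, 29401296, 4605986,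
   50610434, 120119640, 159404192, 135039048, 8808480, 151027744, 17088964, 47202342, 224576,
   176312436, 71936, 76605472, 33702950, 739920, 134349856, 61358362, 600208, 8592464, 239632396,
   67313808, 67519780, 135808014, 42053640, 741072, 42131476, 141580838, 8815968, 34103440,
   50618986, 686096, 11734048, 140855912, 76492032, 169399308, 139778208, 4616704, 201343252,
   17659912, 134825298, 134911184, 33706564, 138596916, 147675200, 5398580, 72624160, 46203032,
   134499208, 201740130, 68174644, 5444240, 138462368, 205540010, 871616, 5010440, 33726468,
   34320784, 26388896, 5357608, 136501584, 134530976, 6828544, 152128392, 140693104, 2184448,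
   815170, 168853520, 19042336, 67789268, 12996836, 76039500, 67477576, 67258466, 2230288,
   67650192, 156864, 203787616, 36192344, 138729056, 446560, 140824620, 2513188, 167920096,
   1136896, 136484960, 4632736, 5783578, 102793268, 151257792, 66084916, 101007912, 12732662,
   100876880, 42295560, 13321234, 8844324, 6688800, 109609052, 167854248, 34370112, 142954824,
   151621776, 51884960, 100951012, 2980672, 4735128, 938438, 84214728, 105046580, 251984,
   116416568, 3432488, 101745428, 38027872, 12601352, 80045282, 88670424, 282888, 13713448,
   807758, 37872200, 1271826, 151572, 68175884, 173098146, 34415168, 69386832, 134255696,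
   71917706, 13793410, 177262616, 136466770, 2377770, 36200532, 67652120, 13781136, 1058816,
   10670416, 135402128, 21568, 8519824, 151638464, 178307112, 152131874, 4526088, 4350996,
   38859792, 36214528, 138759810, 71519328, 21129780, 4882064, 5356176, 76612880, 722704,
   202526130, 75786280, 75785408, 18022960, 2294304, 2249744, 681616, 35803936, 13713464, 6353476,
   8552660, 3174408, 217139224, 145244444, 226754976, 40005712, 27396144, 100876464, 44319840,
   2240768, 8940824, 684098, 117850598, 19091520, 52826464, 6311954, 2392896, 19183872, 34132228,
   36632388, 94412860, 134993344, 68748560, 63217836, 43205810, 77203712, 203852644, 19421456,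
   119562832, 3517696, 56906254, 67674132, 93536434, 6906378, 136679784, 17510480, 4621856,
   46281776, 487584, 2332208, 1344004, 146948210, 146835504, 4327440, 164665392, 1328138,
   21754448, 134893584, 2183200, 69807112, 170135840, 84829124, 67969792, 8474824, 155488900,
   7123976, 6462512, 13184024, 432260, 34423232, 2729040, 72263364, 102859304, 38683846,
   140287116, 168087944, 3394576, 671888, 25725208, 9052224, 17465744, 40011376, 155736656,
   5655078, 87075348, 151175536, 67403820, 153387820, 12615852, 13812912, 134382612, 53580056,
   135011328, 1346944, 70550312, 143934596, 117522770, 168198496, 143347088, 160241856, 140856864,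
   868544, 219168944, 17598656, 1907456, 4528648, 42796488, 35852848, 39867496, 35055232, 5665284,
   122184348, 59924752, 206669880, 75539616, 12883108, 11546624, 3211552, 2559520, 134480928,
   2425096, 134549760, 84689284, 50873026, 209912112, 201672968, 69249032, 134794496, 69815576,
   12867754, 78275600, 12846240, 142805296, 137763616, 184680832, 73739304, 14850160, 38179428,
   4686496, 38872576, 110666008, 67313824, 138707652, 31526936, 105162248, 54603792, 109094044,
   86190624, 50696360, 80830600, 429248, 117514512, 25399440, 17115520, 17367808, 151669508,
   104890892, 172147860, 67838224, 205852288, 164302992, 88148120, 159533104, 203704098, 34230352,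
   4631680, 138562064, 38548032, 135823376, 4461568, 22382752, 4658304, 205588584, 33849700,
   142771360, 185856, 17013024, 29503520, 143267984, 155359392, 9019408, 68070788, 71674408,
   632320, 35889712, 84517392, 37957648, 67799424, 209879312, 137611024, 75033616, 13526150,
   142743808, 42164496, 138680352, 16945444, 134318592, 42648976, 84288032, 73572368, 139363972,
   33792432, 17058336, 135022728, 1488000, 2532644, 4295696, 104890900, 88893580, 79725584,
   8570944, 5406736, 37888, 4433424, 4631204, 67281200, 67879952, 38364184, 363136, 34358150,
   136480816, 21740048, 2663952, 34027136, 50376848, 17441536, 4462624, 4459008, 100926848,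
   68739460, 79809584, 151078928, 168444306, 142655768, 201457824, 6485044, 8692780, 105144330,
   12780688, 9321728, 30019728, 9056400, 918656, 24207904, 68726540, 10569754, 6066304, 101336976,
   8971464, 3045186, 125993136, 1474848, 683074, 67561632, 661520, 956096, 121692172, 201952536,
   126099488, 25329712, 67309344, 218138648, 6387730, 15246360, 201525296, 193007640, 598784,
   84746376, 406048, 55587456, 8653952, 59085032, 84240576, 50565232, 50757984, 79757424,
   79717574, 84388128, 942336, 198688, 143266112, 2559296, 135700000, 4474056, 73589316, 85033344,
   6055560, 295968, 168575752, 19583300, 51662860, 1594514, 16877568, 155259128, 21041728, 196624,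
   50659552, 74491416, 3299602, 68378784, 140528166, 2968136, 218169920, 105022048, 36873252,
   2798144, 177226142, 37520140, 141051464, 6702628, 80833584, 25350436, 222447842, 137578512,
   38867488, 950596, 21016808, 218628416, 4376688, 7710248, 42020952, 167974416, 17111208,
   137697792, 54690480, 58818776, 16779264, 17109120, 17961376, 51646880, 17893384, 20253448,
   1119232, 118784808, 345250, 18956336, 50790432, 152289968, 118924064, 38970000, 208176220,
   4990464, 121676388, 37880544, 139496456, 10848296, 50885080, 2890816, 2967104, 3946240,
   14726156, 23878158, 41793032, 43275530, 5448336, 136451600, 77997344, 73689704, 139546760,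
   68241448, 143104288, 170824512, 4634692, 4720832, 4873750, 172151312, 3543584, 4632128,
   1577216, 136551184, 168050816, 671942, 38298304, 173740688, 3617056, 71846100, 26357776,
   35406088, 33767536, 68493480, 4396560, 72885888, 25655488, 34160728, 12129552, 50659432,
   17666120, 6431792, 4592256, 1182848]

theorem planCheck_fourteenPlan : (planCheck 8 (List.range (2 ^ 14)) fourteenPlan).isSome = true := by
  decide +kernel

variable {n : ℕ}

/-! ### Sorting a restricted family of sets -/

/-- The sets in `S` can be told apart with at most `k` weighings. -/
def Solvable (κ : FakeKind) (S : Set (Finset (Fin n))) (k : ℕ) : Prop :=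
  ∃ t : Procedure n, t.weighings ≤ k ∧
    ∀ a b : ℝ, κ.Admissible a b → ∀ F ∈ S, t.run a b F = F

theorem mem_sufficientNumbers_iff {κ : FakeKind} {k : ℕ} :
    k ∈ sufficientNumbers κ n ↔ Solvable κ (Set.univ : Set (Finset (Fin n))) k := by
  simp [sufficientNumbers, Solvable, Procedure.Sorts]

theorem Solvable.mono {κ : FakeKind} {S T : Set (Finset (Fin n))} {k l : ℕ}
    (h : Solvable κ T k) (hST : S ⊆ T) (hkl : k ≤ l) : Solvable κ S l := by
  obtain ⟨t, ht, h⟩ := h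
  exact ⟨t, ht.trans hkl, fun a b hab F hF => h a b hab F (hST hF)⟩

theorem solvable_of_subset_singleton (κ : FakeKind) {S : Set (Finset (Fin n))}
    {A : Finset (Fin n)} (h : S ⊆ {A}) (k : ℕ) : Solvable κ S k :=
  ⟨.announce A, Nat.zero_le _, fun _ _ _ F hF => (h hF : F = A).symm⟩

theorem panWeight_eq (a b : ℝ) (F P : Finset (Fin n)) (p : ℕ) :
    panWeight a b F P p = (P.card + p : ℕ) * a + ((F ∩ P).card : ℝ) * (b - a) := by
  have h : ∀ i, (if i ∈ F then b else a) = a + if i ∈ F then b - a else 0 := by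
    intro i; split_ifs <;> ring
  simp only [panWeight, h, Finset.sum_add_distrib, Finset.sum_const, nsmul_eq_mul,
    ← Finset.sum_filter, Finset.filter_mem_eq_inter, Finset.inter_comm P F, Nat.cast_add]
  ring

/-- If the sets with equally many, more, and fewer elements in `L` than in `R` are solvable with `k`
weighings, then one more weighing is enough for all sets. -/
theorem Solvable.weigh {κ : FakeKind} {S : Set (Finset (Fin n))} {k : ℕ}
    {L R : Finset (Fin n)} (hLR : Disjoint L R)
    (he : Solvable κ {F ∈ S | (F ∩ L).card = (F ∩ R).card} k)
    (hl : Solvable κ {F ∈ S | (F ∩ R).card < (F ∩ L).card} k)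
    (hr : Solvable κ {F ∈ S | (F ∩ L).card < (F ∩ R).card} k) : Solvable κ S (k + 1) := by
  obtain ⟨te, hte, he⟩ := he
  obtain ⟨tl, htl, hl⟩ := hl
  obtain ⟨tr, htr, hr⟩ := hr
  have hw : ∀ (a b : ℝ) (F : Finset (Fin n)),
      panWeight a b F L R.card - panWeight a b F R L.card =
        (((F ∩ L).card : ℝ) - (F ∩ R).card) * (b - a) := by
    intro a b F
    rw [panWeight_eq, panWeight_eq]
    push_cast
    ring
  cases κ with
  | heavier =>
    refine ⟨.weigh L R hLR R.card L.card te tl tr, by simp [Procedure.weighings, *], ?_⟩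
    intro a b hab F hF
    have hba : 0 < b - a := sub_pos.2 hab.2
    have := hw a b F
    rw [Procedure.run]
    rcases lt_trichotomy (F ∩ L).card (F ∩ R).card with h | h | h
    · have h' : ((F ∩ L).card : ℝ) < (F ∩ R).card := by exact_mod_cast h
      have : panWeight a b F L R.card < panWeight a b F R L.card := by nlinarith
      rw [if_neg this.ne, if_neg this.not_gt]
      exact hr a b hab F ⟨hF, h⟩
    · rw [if_pos (by rw [h] at this; linarith)]
      exact he a b hab F ⟨hF, h⟩
    · have h' : ((F ∩ R).card : ℝ) < (F ∩ L).card := by exact_mod_cast h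
      have : panWeight a b F R L.card < panWeight a b F L R.card := by nlinarith
      rw [if_neg this.ne', if_pos this]
      exact hl a b hab F ⟨hF, h⟩
  | lighter =>
    refine ⟨.weigh L R hLR R.card L.card te tr tl, by simp [Procedure.weighings, *], ?_⟩
    intro a b hab F hF
    have hba : b - a < 0 := sub_neg.2 hab.2
    have := hw a b F
    rw [Procedure.run]
    rcases lt_trichotomy (F ∩ L).card (F ∩ R).card with h | h | h
    · have h' : ((F ∩ L).card : ℝ) < (F ∩ R).card := by exact_mod_cast h
      have : panWeight a b F R L.card < panWeight a b F L R.card := by nlinarith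
      rw [if_neg this.ne', if_pos this]
      exact hr a b hab F ⟨hF, h⟩
    · rw [if_pos (by rw [h] at this; linarith)]
      exact he a b hab F ⟨hF, h⟩
    · have h' : ((F ∩ R).card : ℝ) < (F ∩ L).card := by exact_mod_cast h
      have : panWeight a b F L R.card < panWeight a b F R L.card := by nlinarith
      rw [if_neg this.ne, if_neg this.not_gt]
      exact hl a b hab F ⟨hF, h⟩

/-- Two sets with private elements are told apart from each other and from a third set by weighing
their private elements against each other. -/
theorem solvable_of_private (κ : FakeKind) {S : Set (Finset (Fin n))} {A B C : Finset (Fin n)}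
    (hS : S ⊆ {A, B, C}) (hA : (A \ (B ∪ C)).Nonempty) (hB : (B \ (A ∪ C)).Nonempty) :
    Solvable κ S 1 := by
  have hAA : A ∩ (A \ (B ∪ C)) = A \ (B ∪ C) := by grind
  have hAB : A ∩ (B \ (A ∪ C)) = ∅ := by grind
  have hBA : B ∩ (A \ (B ∪ C)) = ∅ := by grind
  have hBB : B ∩ (B \ (A ∪ C)) = B \ (A ∪ C) := by grind
  have hCA : C ∩ (A \ (B ∪ C)) = ∅ := by grind
  have hCB : C ∩ (B \ (A ∪ C)) = ∅ := by grind
  have hA' := hA.card_pos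
  have hB' := hB.card_pos
  refine Solvable.weigh (k := 0) (L := A \ (B ∪ C)) (R := B \ (A ∪ C))
    (Finset.disjoint_left.2 (by grind))
    (solvable_of_subset_singleton κ (A := C) ?_ 0) (solvable_of_subset_singleton κ (A := A) ?_ 0)
    (solvable_of_subset_singleton κ (A := B) ?_ 0)
  all_goals
    rintro F ⟨hF, h⟩
    rcases hS hF with rfl | rfl | rfl
    all_goals first
      | rfl
      | (exfalso
         simp only [hAA, hAB, hBA, hBB, hCA, hCB, Finset.card_empty] at h
         omega)

theorem solvable_pair (κ : FakeKind) {S : Set (Finset (Fin n))} {A B : Finset (Fin n)}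
    (hS : S ⊆ {A, B}) : Solvable κ S 1 := by
  by_cases hAB : A = B
  · exact solvable_of_subset_singleton κ (A := A) (by simpa [hAB] using hS) 1
  have hAA : A ∩ (A \ B) = A \ B := by grind
  have hA0 : A ∩ (B \ A) = ∅ := by grind
  have hB0 : B ∩ (A \ B) = ∅ := by grind
  have hBB : B ∩ (B \ A) = B \ A := by grind
  have hne : ¬((A \ B).card = 0 ∧ (B \ A).card = 0) := by
    rintro ⟨h1, h2⟩
    exact hAB ((Finset.sdiff_eq_empty_iff_subset.1 (Finset.card_eq_zero.1 h1)).antisymm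
      (Finset.sdiff_eq_empty_iff_subset.1 (Finset.card_eq_zero.1 h2)))
  refine Solvable.weigh (k := 0) (L := A \ B) (R := B \ A) (Finset.disjoint_left.2 (by grind))
    (solvable_of_subset_singleton κ (A := if (A \ B).card = 0 then A else B) ?_ 0)
    (solvable_of_subset_singleton κ (A := A) ?_ 0) (solvable_of_subset_singleton κ (A := B) ?_ 0)
  all_goals
    rintro F ⟨hF, h⟩
    have hF' := hS hF
    simp only [Set.mem_insert_iff, Set.mem_singleton_iff] at hF' ⊢
    rcases hF' with hF' | hF'
    all_goals
      rw [hF'] at h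
      simp only [hAA, hA0, hB0, hBB, Finset.card_empty] at h
      first
        | exact hF'
        | (exfalso; omega)
        | (split_ifs <;> first | exact hF' | (exfalso; omega))

/-! ### Sets of coins encoded by natural numbers -/

/-- The set of coins encoded by the binary digits of `x`. -/
def coins (n x : ℕ) : Finset (Fin n) := Finset.univ.filter fun i => x.testBit i

theorem mem_coins {x : ℕ} {i : Fin n} : i ∈ coins n x ↔ x.testBit i = true := by
  simp [coins]

theorem coins_land (x y : ℕ) : coins n (x.land y) = coins n x ∩ coins n y := by
  ext i
  simp [mem_coins]

theorem coins_privateBits (x y z : ℕ) :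
    coins n (privateBits x y z) = coins n x \ (coins n y ∪ coins n z) := by
  ext i
  have h : (privateBits x y z).testBit i =
      (x.testBit i ^^ (x.testBit i && (y.testBit i || z.testBit i))) := by
    change (x ^^^ (x &&& (y ||| z))).testBit i = _
    simp
  simp only [mem_coins, h, Finset.mem_sdiff, Finset.mem_union]
  cases x.testBit i <;> cases y.testBit i <;> cases z.testBit i <;> simp

theorem privateBits_lt {x y z : ℕ} (hx : x < 2 ^ n) : privateBits x y z < 2 ^ n :=
  Nat.xor_lt_two_pow hx (Nat.and_le_left.trans_lt hx)

theorem exists_coins_eq (F : Finset (Fin n)) : ∃ x < 2 ^ n, coins n x = F := by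
  refine ⟨Nat.ofBits fun i => decide (i ∈ F), Nat.ofBits_lt_two_pow _, ?_⟩
  ext i
  simp [mem_coins, Nat.testBit_ofBits_lt]

theorem popCount_eq_sum : ∀ y < 2 ^ 14, popCount y = ∑ i ∈ Finset.range 14, (y.testBit i).toNat := by
  have h : (List.range (2 ^ 14)).all (fun y => (popCount y).beq
      (y % 2 + y / 2 % 2 + y / 4 % 2 + y / 8 % 2 + y / 16 % 2 + y / 32 % 2 + y / 64 % 2 +
      y / 128 % 2 + y / 256 % 2 + y / 512 % 2 + y / 1024 % 2 + y / 2048 % 2 + y / 4096 % 2 +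
      y / 8192 % 2)) = true := by
    decide +kernel
  intro y hy
  rw [Nat.eq_of_beq_eq_true (List.all_eq_true.1 h y (List.mem_range.2 hy))]
  simp [Finset.sum_range_succ, Nat.toNat_testBit]

theorem card_coins (hn : n ≤ 14) {y : ℕ} (hy : y < 2 ^ n) : (coins n y).card = popCount y := by
  rw [popCount_eq_sum y (hy.trans_le (Nat.pow_le_pow_right two_pos hn)), coins,
    Finset.card_filter, Fin.sum_univ_eq_sum_range (fun i => if y.testBit i = true then 1 else 0) n]
  refine (Finset.sum_congr rfl fun i _ => ?_).trans
    (Finset.sum_subset (Finset.range_subset_range.2 hn) fun i _ hi => ?_)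
  · cases y.testBit i <;> rfl
  · rw [Nat.testBit_lt_two_pow (hy.trans_le (Nat.pow_le_pow_right two_pos (by simpa using hi)))]
    rfl

theorem card_coins_inter (hn : n ≤ 14) {x : ℕ} (hx : x < 2 ^ n) (y : ℕ) :
    (coins n x ∩ coins n y).card = popCount (x.land y) := by
  rw [← coins_land, card_coins hn (show x.land y < 2 ^ n from Nat.and_le_left.trans_lt hx)]

theorem solvable_of_separated (κ : FakeKind) (hn : n ≤ 14) {x y z : ℕ} (hx : x < 2 ^ n)
    (hy : y < 2 ^ n) (h : separated x y z = true) {S : Set (Finset (Fin n))}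
    (hS : S ⊆ {coins n x, coins n y, coins n z}) : Solvable κ S 1 := by
  rw [separated, Bool.and_eq_true, Nat.ble_eq, Nat.ble_eq, ← card_coins hn (privateBits_lt hx),
    ← card_coins hn (privateBits_lt hy), coins_privateBits, coins_privateBits] at h
  exact solvable_of_private κ hS (Finset.card_pos.1 h.1) (Finset.card_pos.1 h.2)

theorem solvable_of_finalCheck (κ : FakeKind) (hn : n ≤ 14) {S : List ℕ}
    (hS : ∀ x ∈ S, x < 2 ^ n) (h : finalCheck S = true) :
    Solvable κ (coins n '' {x | x ∈ S}) 1 := by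
  match S with
  | [] => exact solvable_of_subset_singleton κ (A := ∅) (by simp) 1
  | [x] => exact solvable_of_subset_singleton κ (A := coins n x) (by simp) 1
  | [x, y] =>
    exact solvable_pair κ (A := coins n x) (B := coins n y)
      (by rintro _ ⟨w, hw, rfl⟩; simp at hw ⊢; grind)
  | [x, y, z] =>
    simp only [List.mem_cons, List.not_mem_nil, or_false, forall_eq_or_imp, forall_eq] at hS
    simp only [finalCheck, Bool.or_eq_true] at h
    rcases h with (h | h) | h
    · exact solvable_of_separated κ hn hS.1 hS.2.1 h (by rintro _ ⟨w, hw, rfl⟩; simp at hw ⊢; grind)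
    · exact solvable_of_separated κ hn hS.1 hS.2.2 h (by rintro _ ⟨w, hw, rfl⟩; simp at hw ⊢; grind)
    · exact solvable_of_separated κ hn hS.2.1 hS.2.2 h
        (by rintro _ ⟨w, hw, rfl⟩; simp at hw ⊢; grind)
  | _ :: _ :: _ :: _ :: _ => simp [finalCheck] at h

theorem popCount_xor_add {x l r : ℕ} (hx : x < 2 ^ 14) (hr : r < 2 ^ 14) (hlr : l.land r = 0) :
    popCount ((x.land (l.lor r)).xor r) + popCount (x.land r) =
      popCount (x.land l) + popCount r := by
  have hy : (x.land (l.lor r)).xor r < 2 ^ 14 := Nat.xor_lt_two_pow (Nat.and_le_left.trans_lt hx) hr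
  have h : coins 14 ((x.land (l.lor r)).xor r) =
      (coins 14 x ∩ coins 14 l) ∪ (coins 14 r \ coins 14 x) := by
    ext i
    have h₁ : (l &&& r).testBit i = false := by
      rw [show l &&& r = 0 from hlr, Nat.zero_testBit]
    have h₂ : ((x.land (l.lor r)).xor r).testBit i =
        ((x.testBit i && (l.testBit i || r.testBit i)) ^^ r.testBit i) := by
      change ((x &&& (l ||| r)) ^^^ r).testBit i = _
      simp
    rw [Nat.testBit_land] at h₁
    simp only [mem_coins, h₂, Finset.mem_sdiff, Finset.mem_union, Finset.mem_inter]
    revert h₁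
    cases x.testBit i <;> cases l.testBit i <;> cases r.testBit i <;> simp
  have hd : Disjoint (coins 14 x ∩ coins 14 l) (coins 14 r \ coins 14 x) :=
    Finset.disjoint_left.2 (by grind)
  rw [← card_coins_inter le_rfl hx, ← card_coins_inter le_rfl hx, ← card_coins le_rfl hy, ← card_coins le_rfl hr, h, Finset.card_union_of_disjoint hd,
    ← Finset.card_sdiff_add_card_inter (coins 14 r) (coins 14 x), Finset.inter_comm (coins 14 r)]
  ring

theorem sift_eq (m q c : ℕ) (S e l r : List ℕ) :
    sift m q c S e l r =
      ((S.filter fun x => popCount ((x.land m).xor q) = c).reverse ++ e,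
        (S.filter fun x => c < popCount ((x.land m).xor q)).reverse ++ l,
        (S.filter fun x => popCount ((x.land m).xor q) < c).reverse ++ r) := by
  induction S generalizing e l r with
  | nil => rfl
  | cons x S ih =>
    have h : sift m q c (x :: S) e l r =
        bif Nat.beq (popCount ((x.land m).xor q)) c then sift m q c S (x :: e) l r
        else bif Nat.ble c (popCount ((x.land m).xor q)) then sift m q c S e (x :: l) r
        else sift m q c S e l (x :: r) := rfl
    rw [h]
    simp only [List.filter_cons]
    generalize popCount ((x.land m).xor q) = k
    rcases lt_trichotomy k c with hk | rfl | hk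
    · rw [Bool.eq_false_iff.2 fun h => hk.ne (Nat.eq_of_beq_eq_true h),
        Bool.eq_false_iff.2 fun h => hk.not_ge (Nat.le_of_ble_eq_true h), cond_false, cond_false, ih]
      simp [hk, hk.ne, hk.not_gt]
    · rw [Nat.beq_refl, cond_true, ih]
      simp
    · rw [Bool.eq_false_iff.2 fun h => hk.ne' (Nat.eq_of_beq_eq_true h),
        Nat.ble_eq_true_of_le hk.le, cond_false, cond_true, ih]
      simp [hk, hk.ne', hk.not_gt]

theorem solvable_of_planCheck (κ : FakeKind) (hn : n ≤ 14) (d : ℕ) :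
    ∀ (S c c' : List ℕ), (∀ x ∈ S, x < 2 ^ n) → planCheck d S c = some c' →
      Solvable κ (coins n '' {x | x ∈ S}) (d + 1) := by
  induction d with
  | zero =>
    intro S c c' hS h
    rw [planCheck] at h
    cases hf : finalCheck S with
    | false => simp [hf] at h
    | true => exact solvable_of_finalCheck κ hn hS hf
  | succ d ih =>
    intro S c c' hS h
    cases c with
    | nil => simp [planCheck] at h
    | cons w c =>
      rw [planCheck, sift_eq] at h
      have hr : w.mod 16384 < 2 ^ 14 := Nat.mod_lt _ (by norm_num)
      generalize w.div 16384 = l, w.mod 16384 = r at h hr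
      cases hd : Nat.beq (l.land r) 0 with
      | false => rw [hd] at h; cases h
      | true =>
        rw [hd, cond_true] at h
        simp only [Option.bind_eq_some_iff, List.append_nil] at h
        obtain ⟨c₁, h₁, c₂, h₂, h₃⟩ := h
        have hF : ∀ p : ℕ → Bool, ∀ x ∈ (S.filter p).reverse, x < 2 ^ n :=
          fun p x hx => hS x (List.mem_filter.1 (List.mem_reverse.1 hx)).1
        refine Solvable.weigh (L := coins n l) (R := coins n r) ?_
          ((ih _ _ _ (hF _) h₁).mono ?_ le_rfl) ((ih _ _ _ (hF _) h₂).mono ?_ le_rfl)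
          ((ih _ _ _ (hF _) h₃).mono ?_ le_rfl)
        · rw [Finset.disjoint_iff_inter_eq_empty, ← coins_land, Nat.eq_of_beq_eq_true hd]
          simp [coins]
        all_goals
          rintro _ ⟨⟨x, hx, rfl⟩, h⟩
          rw [card_coins_inter hn (hS x hx), card_coins_inter hn (hS x hx)] at h
          have := popCount_xor_add ((hS x hx).trans_le (Nat.pow_le_pow_right two_pos hn)) hr
            (Nat.eq_of_beq_eq_true hd)
          refine ⟨x, List.mem_reverse.2 (List.mem_filter.2 ⟨hx, decide_eq_true ?_⟩), rfl⟩
          omega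

theorem mem_sufficientNumbers_of_planCheck (κ : FakeKind) (hn : n ≤ 14) {d : ℕ} {c : List ℕ}
    (h : (planCheck d (List.range (2 ^ n)) c).isSome = true) :
    d + 1 ∈ sufficientNumbers κ n := by
  obtain ⟨c', h⟩ := Option.isSome_iff_exists.1 h
  refine mem_sufficientNumbers_iff.2
    ((solvable_of_planCheck κ hn d _ c c' (fun x => List.mem_range.1) h).mono ?_ le_rfl)
  intro F _
  obtain ⟨x, hx, rfl⟩ := exists_coins_eq F
  exact ⟨x, List.mem_range.2 hx, rfl⟩

/-! ### Sorting two groups of coins one after the other -/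

/-- The procedure that treats the coins `φ i` as `t` treats the coins `i`, and goes on with `f A`
where `t` announces `A`. -/
def Procedure.bind {m n : ℕ} (φ : Fin m ↪ Fin n) :
    Procedure m → (Finset (Fin m) → Procedure n) → Procedure n
  | .announce A, f => f A
  | .weigh L R d p q e l r, f =>
    .weigh (L.map φ) (R.map φ) ((Finset.disjoint_map φ).2 d) p q (e.bind φ f) (l.bind φ f)
      (r.bind φ f)

theorem panWeight_map {m n : ℕ} (φ : Fin m ↪ Fin n) (a b : ℝ) (F : Finset (Fin n))
    (P : Finset (Fin m)) (p : ℕ) :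
    panWeight a b F (P.map φ) p = panWeight a b (F.preimage φ φ.injective.injOn) P p := by
  simp [panWeight]

theorem Procedure.run_bind {m n : ℕ} (φ : Fin m ↪ Fin n) (a b : ℝ) (F : Finset (Fin n))
    (t : Procedure m) (f : Finset (Fin m) → Procedure n) :
    (t.bind φ f).run a b F = (f (t.run a b (F.preimage φ φ.injective.injOn))).run a b F := by
  induction t with
  | announce A => rfl
  | weigh L R d p q e l r ihe ihl ihr =>
    simp only [Procedure.bind, Procedure.run, panWeight_map]
    split_ifs <;> assumption

theorem Procedure.weighings_bind_le {m n k : ℕ} (φ : Fin m ↪ Fin n) (t : Procedure m)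
    (f : Finset (Fin m) → Procedure n) (hf : ∀ A, (f A).weighings ≤ k) :
    (t.bind φ f).weighings ≤ t.weighings + k := by
  induction t with
  | announce A => simpa [Procedure.bind, Procedure.weighings] using hf A
  | weigh L R d p q e l r ihe ihl ihr =>
    simp only [Procedure.bind, Procedure.weighings]
    omega

theorem add_mem_sufficientNumbers {κ : FakeKind} {m n k l : ℕ} (hm : k ∈ sufficientNumbers κ m)
    (hn : l ∈ sufficientNumbers κ n) : k + l ∈ sufficientNumbers κ (m + n) := by
  obtain ⟨t, ht, hts⟩ := hm
  obtain ⟨u, hu, hus⟩ := hn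
  refine ⟨t.bind (Fin.castAddEmb n) fun A => u.bind (Fin.natAddEmb m) fun B =>
    .announce (A.map (Fin.castAddEmb n) ∪ B.map (Fin.natAddEmb m)), ?_, ?_⟩
  · refine (Procedure.weighings_bind_le (k := l) _ _ _ fun A => ?_).trans
      (Nat.add_le_add_right ht l)
    exact (Procedure.weighings_bind_le (k := 0) _ _ _ fun B => le_rfl).trans hu
  · intro a b hab F
    rw [Procedure.run_bind, Procedure.run_bind, Procedure.run, hts a b hab, hus a b hab]
    ext i
    refine Fin.addCases (fun j => ?_) (fun j => ?_) i
    · simp only [Finset.mem_union, Finset.mem_map, Finset.mem_preimage, Fin.castAddEmb_apply,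
        Fin.natAddEmb_apply]
      constructor
      · rintro (⟨x, hx, h⟩ | ⟨x, hx, h⟩)
        · exact h ▸ hx
        · exact h ▸ hx
      · exact fun h => Or.inl ⟨j, h, rfl⟩
    · simp only [Finset.mem_union, Finset.mem_map, Finset.mem_preimage, Fin.castAddEmb_apply,
        Fin.natAddEmb_apply]
      constructor
      · rintro (⟨x, hx, h⟩ | ⟨x, hx, h⟩)
        · exact h ▸ hx
        · exact h ▸ hx
      · exact fun h => Or.inr ⟨j, h, rfl⟩

theorem zero_mem_sufficientNumbers (κ : FakeKind) : 0 ∈ sufficientNumbers κ 0 :=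
  ⟨.announce ∅, le_rfl, fun _ _ _ _ => Subsingleton.elim _ _⟩

theorem one_mem_sufficientNumbers (κ : FakeKind) : 1 ∈ sufficientNumbers κ 1 :=
  mem_sufficientNumbers_of_planCheck κ (d := 0) (c := []) (by norm_num) rfl

theorem self_mem_sufficientNumbers (κ : FakeKind) (n : ℕ) : n ∈ sufficientNumbers κ n := by
  induction n with
  | zero => exact zero_mem_sufficientNumbers κ
  | succ n ih => exact add_mem_sufficientNumbers ih (one_mem_sufficientNumbers κ)

/-- The least natural number above `7 n / 11` suffices for `n ≠ 3`. -/
theorem div_mem_sufficientNumbers (κ : FakeKind) (n : ℕ) (hn : n ≠ 3) :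
    (7 * n + 10) / 11 ∈ sufficientNumbers κ n := by
  have h1 := one_mem_sufficientNumbers κ
  have h2 := self_mem_sufficientNumbers κ 2
  have h4 : 3 ∈ sufficientNumbers κ 4 :=
    mem_sufficientNumbers_of_planCheck κ (by norm_num) planCheck_fourPlan
  have h6 : 4 ∈ sufficientNumbers κ 6 :=
    mem_sufficientNumbers_of_planCheck κ (by norm_num) planCheck_sixPlan
  have h9 : 6 ∈ sufficientNumbers κ 9 :=
    mem_sufficientNumbers_of_planCheck κ (by norm_num) planCheck_ninePlan
  have h11 : 7 ∈ sufficientNumbers κ 11 :=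
    mem_sufficientNumbers_of_planCheck κ (by norm_num) planCheck_elevenPlan
  have h14 : 9 ∈ sufficientNumbers κ 14 :=
    mem_sufficientNumbers_of_planCheck κ (by norm_num) planCheck_fourteenPlan
  induction n using Nat.strong_induction_on with
  | _ n ih =>
    rcases lt_or_ge n 11 with h | h
    · interval_cases n
      · exact zero_mem_sufficientNumbers κ
      · exact h1
      · exact h2
      · exact absurd rfl hn
      · exact h4
      · exact add_mem_sufficientNumbers h4 h1
      · exact h6
      · exact add_mem_sufficientNumbers h6 h1
      · exact add_mem_sufficientNumbers h6 h2
      · exact h9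
      · exact add_mem_sufficientNumbers h6 h4
    · rcases eq_or_ne n 14 with rfl | h'
      · exact h14
      · obtain ⟨m, rfl⟩ := Nat.exists_eq_add_of_le' h
        have := add_mem_sufficientNumbers (ih m (by omega) (by omega)) h11
        rwa [show (7 * m + 10) / 11 + 7 = (7 * (m + 11) + 10) / 11 by omega] at this

/-! ### Lower bounds -/

theorem FakeKind.exists_admissible (κ : FakeKind) : ∃ a b, κ.Admissible a b := by
  cases κ
  · exact ⟨1, 2, by norm_num [FakeKind.Admissible]⟩
  · exact ⟨2, 1, by norm_num [FakeKind.Admissible]⟩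

theorem Procedure.card_image_run_le (a b : ℝ) (t : Procedure n) (S : Finset (Finset (Fin n))) :
    (S.image (t.run a b)).card ≤ 3 ^ t.weighings := by
  induction t with
  | announce A =>
    refine (Finset.card_le_card (t := {A}) ?_).trans (Finset.card_singleton A).le
    intro B hB
    obtain ⟨F, -, rfl⟩ := Finset.mem_image.1 hB
    simp [Procedure.run]
  | weigh L R d p q e l r ihe ihl ihr =>
    have hsub : S.image ((Procedure.weigh L R d p q e l r).run a b) ⊆
        S.image (e.run a b) ∪ (S.image (l.run a b) ∪ S.image (r.run a b)) := by
      intro B hB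
      obtain ⟨F, hF, rfl⟩ := Finset.mem_image.1 hB
      rw [Procedure.run]
      split_ifs
      · exact Finset.mem_union_left _ (Finset.mem_image_of_mem _ hF)
      · exact Finset.mem_union_right _ (Finset.mem_union_left _ (Finset.mem_image_of_mem _ hF))
      · exact Finset.mem_union_right _ (Finset.mem_union_right _ (Finset.mem_image_of_mem _ hF))
    have hpow : ∀ {i j : ℕ}, i ≤ j → 3 ^ i ≤ 3 ^ j := Nat.pow_le_pow_right (by norm_num)
    set M := max e.weighings (max l.weighings r.weighings) with hM
    have he := ihe.trans (hpow (show e.weighings ≤ M by omega))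
    have hl := ihl.trans (hpow (show l.weighings ≤ M by omega))
    have hr := ihr.trans (hpow (show r.weighings ≤ M by omega))
    have h := (Finset.card_le_card hsub).trans ((Finset.card_union_le _ _).trans
      (Nat.add_le_add_left (Finset.card_union_le _ _) _))
    rw [Procedure.weighings, ← hM, pow_succ]
    omega

/-- A procedure that identifies all sets in `S` has at least `S.card` outcomes. -/
theorem Procedure.card_le_of_run_eq {a b : ℝ} {t : Procedure n} {S : Finset (Finset (Fin n))}
    (h : ∀ F ∈ S, t.run a b F = F) : S.card ≤ 3 ^ t.weighings := by
  have := t.card_image_run_le a b S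
  rwa [Finset.image_congr (g := id) (fun F hF => h F hF), Finset.image_id] at this

theorem two_pow_le_three_pow {κ : FakeKind} {k : ℕ} (hk : k ∈ sufficientNumbers κ n) :
    2 ^ n ≤ 3 ^ k := by
  obtain ⟨t, ht, hs⟩ := hk
  obtain ⟨a, b, hab⟩ := κ.exists_admissible
  have := Procedure.card_le_of_run_eq (S := Finset.univ) fun F _ => hs a b hab F
  rw [Finset.card_univ, Fintype.card_finset, Fintype.card_fin] at this
  exact this.trans (Nat.pow_le_pow_right (by norm_num) ht)

theorem ceil_mul_logb_le {κ : FakeKind} {k : ℕ} (hk : k ∈ sufficientNumbers κ n) :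
    ⌈(n : ℝ) * Real.logb 3 2⌉₊ ≤ k := by
  rw [Nat.ceil_le, ← Real.logb_pow, Real.logb_le_iff_le_rpow (by norm_num) (by positivity),
    Real.rpow_natCast]
  exact_mod_cast two_pow_le_three_pow hk

/-- Any weighing of some of three coins has an outcome that four sets have in common. -/
theorem exists_four_le_card (L R : Finset (Fin 3)) (h : Disjoint L R) :
    4 ≤ (Finset.univ.filter fun F : Finset (Fin 3) => (F ∩ L).card = (F ∩ R).card).card ∨
    4 ≤ (Finset.univ.filter fun F : Finset (Fin 3) => (F ∩ R).card < (F ∩ L).card).card ∨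
    4 ≤ (Finset.univ.filter fun F : Finset (Fin 3) => (F ∩ L).card < (F ∩ R).card).card := by
  revert L R
  decide +kernel

/-- For suitable weights, a weighing of some of three coins either always has the same outcome or
only compares the numbers of fakes. -/
theorem FakeKind.exists_admissible_four_le_card (κ : FakeKind) :
    ∃ a b, κ.Admissible a b ∧ ∀ (L R : Finset (Fin 3)) (p q : ℕ), Disjoint L R →
      ∃ S : Finset (Finset (Fin 3)), 4 ≤ S.card ∧
        ((∀ F ∈ S, panWeight a b F L p = panWeight a b F R q) ∨
          (∀ F ∈ S, panWeight a b F R q < panWeight a b F L p) ∨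
          (∀ F ∈ S, panWeight a b F L p < panWeight a b F R q)) := by
  obtain ⟨ε, hε, hadm⟩ : ∃ ε : ℤ, (ε = 1 ∨ ε = -1) ∧ κ.Admissible 4 (4 + ε) := by
    cases κ
    · exact ⟨1, by norm_num [FakeKind.Admissible]⟩
    · exact ⟨-1, by norm_num [FakeKind.Admissible]⟩
  refine ⟨4, 4 + ε, hadm, fun L R p q hLR => ?_⟩
  have hw : ∀ (F P : Finset (Fin 3)) (p : ℕ), panWeight 4 (4 + ε) F P p =
      ((((P.card + p : ℕ) : ℤ) * 4 + (F ∩ P).card * ε : ℤ) : ℝ) := by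
    intro F P p
    rw [panWeight_eq]
    push_cast
    ring
  simp only [hw, Int.cast_inj, Int.cast_lt]
  have hc : ∀ F P : Finset (Fin 3), (F ∩ P).card ≤ 3 := fun F P => by
    simpa using Finset.card_le_univ (F ∩ P)
  rcases lt_trichotomy (L.card + p) (R.card + q) with h | h | h
  · refine ⟨Finset.univ, by decide, Or.inr (Or.inr fun F _ => ?_)⟩
    have := hc F L
    have := hc F R
    rcases hε with rfl | rfl <;> omega
  · rw [h]
    rcases exists_four_le_card L R hLR with h | h | h
    · refine ⟨_, h, Or.inl fun F hF => ?_⟩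
      rw [(Finset.mem_filter.1 hF).2]
    all_goals
      refine ⟨_, h, Or.inr ?_⟩
      rcases hε with rfl | rfl
      all_goals first
        | (refine Or.inl fun F hF => ?_
           have := (Finset.mem_filter.1 hF).2
           omega)
        | (refine Or.inr fun F hF => ?_
           have := (Finset.mem_filter.1 hF).2
           omega)
  · refine ⟨Finset.univ, by decide, Or.inr (Or.inl fun F _ => ?_)⟩
    have := hc F L
    have := hc F R
    rcases hε with rfl | rfl <;> omega

theorem three_le_of_mem_sufficientNumbers {κ : FakeKind} {k : ℕ}
    (hk : k ∈ sufficientNumbers κ 3) : 3 ≤ k := by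
  obtain ⟨t, ht, hs⟩ := hk
  by_contra! hlt
  obtain ⟨a, b, hab, h⟩ := κ.exists_admissible_four_le_card
  cases t with
  | announce A => exact absurd ((hs a b hab ∅).symm.trans (hs a b hab Finset.univ)) (by decide)
  | weigh L R d p q e l r =>
    have hsmall : ∀ (u : Procedure 3) (S : Finset (Finset (Fin 3))), u.weighings ≤ 1 →
        4 ≤ S.card → ¬∀ F ∈ S, u.run a b F = F := by
      intro u S hu hS hrun
      have := (Procedure.card_le_of_run_eq hrun).trans (Nat.pow_le_pow_right (by norm_num) hu)
      omega
    rw [Procedure.weighings] at ht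
    have hrun := hs a b hab
    simp only [Procedure.run] at hrun
    obtain ⟨S, hS, h | h | h⟩ := h L R p q d
    · refine hsmall e S (by omega) hS fun F hF => ?_
      simpa [h F hF] using hrun F
    · refine hsmall l S (by omega) hS fun F hF => ?_
      simpa [h F hF, (h F hF).ne'] using hrun F
    · refine hsmall r S (by omega) hS fun F hF => ?_
      simpa [(h F hF).ne, (h F hF).not_gt] using hrun F

theorem isLeast_g (κ : FakeKind) (n : ℕ) : IsLeast (sufficientNumbers κ n) (g κ n) :=
  ⟨Nat.sInf_mem ⟨n, self_mem_sufficientNumbers κ n⟩, fun _ hk => Nat.sInf_le hk⟩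

end CoinWeighing

theorem proposition1 (κ : CoinWeighing.FakeKind) :
    (∀ n : ℕ, IsLeast (CoinWeighing.sufficientNumbers κ n) (CoinWeighing.g κ n)) ∧
    (∀ n : ℕ, ⌈(n : ℝ) * Real.logb 3 2⌉₊ ≤ CoinWeighing.g κ n) ∧
    (∀ n : ℕ, n ≠ 3 → CoinWeighing.g κ n ≤ ⌈(7 * (n : ℝ)) / 11⌉₊) ∧
    CoinWeighing.g κ 3 = 3 := by
  refine ⟨CoinWeighing.isLeast_g κ,
    fun n => CoinWeighing.ceil_mul_logb_le (CoinWeighing.isLeast_g κ n).1, fun n hn => ?_,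
    le_antisymm ((CoinWeighing.isLeast_g κ 3).2 (CoinWeighing.self_mem_sufficientNumbers κ 3))
      (CoinWeighing.three_le_of_mem_sufficientNumbers (CoinWeighing.isLeast_g κ 3).1)⟩
  refine ((CoinWeighing.isLeast_g κ n).2 (CoinWeighing.div_mem_sufficientNumbers κ n hn)).trans ?_
  have h : 7 * (n : ℝ) ≤ 11 * (⌈(7 * (n : ℝ)) / 11⌉₊ : ℝ) := by
    have := Nat.le_ceil ((7 * (n : ℝ)) / 11)
    linarith
  have h' : 7 * n ≤ 11 * ⌈(7 * (n : ℝ)) / 11⌉₊ := by exact_mod_cast h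
  omega
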